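/- Let $f$ be a probability density on $\mathbb{R}$, let $X$ have density $f$, and let $Z\sim\mathcal N(0,1)$ be independent of $X$. For $t>0$ let $$p(x,t)=\int_{\mathbb{R}} f(y)\,\frac{1}{\sqrt{2\pi t}}\,e^{-\frac{(x-y)^2}{2t}}\,dy$$ be the density of $X_t=X+\sqrt t\,Z$. For a probability density $g$ and $\alpha\in(0,\infty)\setminus\{1\}$ let $$h_\alpha(g)=\frac{1}{1-\alpha}\log\int g^\alpha\,dx,\qquad \hat h_\alpha(g)=\frac{1}{1-\alpha}\Bigl(\int g^\alpha\,dx-1\Bigr)$$ be the Rényi and Tsallis entropies of order $\alpha$, and let $h_1(g)=\hat h_1(g)=-\int g\log g\,dx$. Put $t_\alpha=\sup\{s\in(0,\infty): |h_\alpha(p(\cdot,s))|<\infty\}$. **Theorem.** Let $\alpha\in[0.93,2]$. For every $t\in(0,t_\alpha)$ the Tsallis entropy $\hat h_\alpha(p(\cdot,t))$ is finite, the function $s\mapsto\hat h_\alpha(p(\cdot,s))$ is four times differentiable at $t$, and $$\frac{\partial^4}{\partial t^4}\,\hat h_\alpha(p(\cdot,t))\le 0 .$$ -/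

import Mathlib

/-- `f` is a probability density on `ℝ` with respect to Lebesgue measure. -/
structure IsProbDensity (f : ℝ → ℝ) : Prop where
  nonneg : ∀ x, 0 ≤ f x
  integrable : MeasureTheory.Integrable f
  integral_eq_one : ∫ x, f x = 1

/-- The density `x ↦ p(x,t)` of `X + √t Z`, where `X` has density `f` and `Z` is a standard
Gaussian variable independent of `X` (for `t > 0`). -/
noncomputable def heatDensity (f : ℝ → ℝ) (t : ℝ) (x : ℝ) : ℝ :=
  ∫ y, f y * (1 / Real.sqrt (2 * Real.pi * t) * Real.exp (-(x - y) ^ 2 / (2 * t)))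

/-- The extended-real-valued Rényi entropy of order `α ∈ (0,∞)` of a density `g`:
`(1/(1-α)) log ∫ g^α` for `α ≠ 1`, and the Shannon entropy `-∫ g log g` for `α = 1`, written as
the difference of the integrals of the positive and negative parts of `-g log g`. -/
noncomputable def renyiEntropy (α : ℝ) (g : ℝ → ℝ) : EReal :=
  if α = 1 then
    ((∫⁻ x, ENNReal.ofReal (Real.negMulLog (g x)) : ENNReal) : EReal)
      - ((∫⁻ x, ENNReal.ofReal (-Real.negMulLog (g x)) : ENNReal) : EReal)
  else ((1 / (1 - α) : ℝ) : EReal) * ENNReal.log (∫⁻ x, ENNReal.ofReal (g x ^ α))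

/-- The Tsallis entropy of order `α ∈ (0,∞)` of a density `g` for which it is finite:
`(1/(1-α)) (∫ g^α - 1)` for `α ≠ 1`, and the Shannon entropy `-∫ g log g` for `α = 1`. -/
noncomputable def tsallisEntropy (α : ℝ) (g : ℝ → ℝ) : ℝ :=
  if α = 1 then ∫ x, Real.negMulLog (g x)
  else 1 / (1 - α) * ((∫ x, g x ^ α) - 1)

/-- `t_α`, the supremum (in the extended reals) of the times `s > 0` at which the Rényi entropy
of order `α` of `p(·,s)` is finite. -/
noncomputable def entropyTime (α : ℝ) (f : ℝ → ℝ) : EReal :=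
  sSup ((fun s : ℝ => (s : EReal)) ''
    {s : ℝ | 0 < s ∧ renyiEntropy α (heatDensity f s) ≠ ⊥ ∧
      renyiEntropy α (heatDensity f s) ≠ ⊤})

/-!
Write `p(s, x)` for the density at time `s` and `vₖ = ∂ₓᵏ p / p`. Since `p` solves the heat equation
`∂ₛ p = ∂ₓ² p / 2`, both `∂ₓ` and `2 ∂ₛ` map an expression `p ^ α Q(v)`, with `Q` a polynomial in
the `vₖ`, to another expression of this kind; on polynomials they act by the operators `spaceOp` and
`timeOp`. Every time derivative of the Tsallis entropy after the zeroth is therefore a constant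
times an integral `∫ p ^ α Q(v)` (`ratioIntegral`), where `Q` matters only modulo the image of
`spaceOp`, that is, up to integration by parts (`ratioIntegral_spaceOp`).

The first derivative is `α / 2 * ∫ p ^ α v₁ ^ 2` for all `α`, the Shannon case `α = 1` included
(`hasDerivAt_tsallisEntropy`). With `β = 2 - α`, the next two are multiples of the integrals of
`secondPoly β` and `thirdPoly β`, and the fourth is `α / 16` times the integral of
`timeOp α (thirdPoly β)`. Adding `spaceOp α W` for a suitable `W` (`boundaryPoly`) turns this last
polynomial into minus a quadratic form in `v₄`, `v₁ v₃`, `v₂ ^ 2`, `v₁ ^ 2 v₂`, `v₁ ^ 4`, which is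
positive semidefinite for `0 ≤ β ≤ 1.07` (`exists_eval_timeOp_thirdPoly_nonpos`). Hence the
integrand is pointwise nonpositive up to a total derivative.

The analytic point is the domination that justifies all this when nothing but the finiteness of the
entropy at one later time `T` is known. With `P = p(T, ·)`, one has `|vₖ| ≤ C (P / p) ^ θ` for every
`θ ∈ (0, 1]`, locally uniformly in time (`exists_abs_heatDeriv_le`): the polynomial factors of the
differentiated Gaussian are absorbed by `exp (θ δ z ^ 2)`, which is interpolated between `1` and the
factor `exp (δ z ^ 2)` gained by raising the variance to `T`. As `p ≤ C P`, every `p ^ α |Q(v)|` is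
at most `C P ^ α` (`exists_abs_rpow_mul_eval_le`), which is integrable by the choice of `T`.
-/

open MeasureTheory Filter Topology

/-! ### Space and time derivatives of the Gaussian density -/

/-- The `k`-th space derivative at `z` of the Gaussian density of variance `s`, given by the
three-term recursion of the Hermite functions. -/
noncomputable def gaussDeriv : ℕ → ℝ → ℝ → ℝ
  | 0, s, z => 1 / Real.sqrt (2 * Real.pi * s) * Real.exp (-z ^ 2 / (2 * s))
  | 1, s, z => -(z / s) * (1 / Real.sqrt (2 * Real.pi * s) * Real.exp (-z ^ 2 / (2 * s)))
  | k + 2, s, z => -(z / s) * gaussDeriv (k + 1) s z - ((k + 1 : ℝ) / s) * gaussDeriv k s z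

theorem gaussDeriv_zero_pos {s : ℝ} (hs : 0 < s) (z : ℝ) : 0 < gaussDeriv 0 s z := by
  rw [gaussDeriv]; positivity

theorem gaussDeriv_one (s z : ℝ) : gaussDeriv 1 s z = -(z / s) * gaussDeriv 0 s z := by
  rw [gaussDeriv, gaussDeriv]

theorem gaussDeriv_add_two (k : ℕ) (s z : ℝ) : gaussDeriv (k + 2) s z =
    -(z / s) * gaussDeriv (k + 1) s z - ((k + 1 : ℝ) / s) * gaussDeriv k s z := by
  rw [gaussDeriv]

theorem HasDerivAt.congr_fun_deriv {f g : ℝ → ℝ} {f' g' x : ℝ} (h : HasDerivAt f f' x)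
    (hf : ∀ y, g y = f y) (hf' : f' = g') : HasDerivAt g g' x := by
  rw [show g = f from funext hf, ← hf']; exact h

theorem hasDerivAt_gaussDeriv_space {s : ℝ} (hs : 0 < s) (k : ℕ) (z : ℝ) :
    HasDerivAt (gaussDeriv k s) (gaussDeriv (k + 1) s z) z := by
  have h0 : ∀ z, HasDerivAt (gaussDeriv 0 s) (gaussDeriv 1 s z) z := by
    intro z
    have h : HasDerivAt (fun z : ℝ => -z ^ 2 / (2 * s)) (-(z / s)) z :=
      ((hasDerivAt_pow 2 z).neg.div_const (2 * s)).congr_fun_deriv (fun _ => rfl)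
        (by field_simp; norm_num)
    refine (h.exp.const_mul (1 / Real.sqrt (2 * Real.pi * s))).congr_fun_deriv
      (fun y => by rw [gaussDeriv]) ?_
    rw [gaussDeriv_one, gaussDeriv]; ring
  have hdiv : HasDerivAt (fun z : ℝ => -(z / s)) (-(1 / s)) z :=
    ((hasDerivAt_id z).div_const s).neg
  induction k using Nat.twoStepInduction generalizing z with
  | zero => exact h0 z
  | one =>
    refine (hdiv.mul (h0 z)).congr_fun_deriv (fun y => gaussDeriv_one s y) ?_
    rw [gaussDeriv_add_two 0]; simp; ring
  | more k ih1 ih2 =>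
    refine ((hdiv.mul (ih2 z hdiv)).sub
      ((ih1 z hdiv).const_mul ((k + 1 : ℝ) / s))).congr_fun_deriv
      (fun y => gaussDeriv_add_two k s y) ?_
    rw [show k + 2 + 1 = (k + 1) + 2 from rfl, gaussDeriv_add_two (k + 1)]; push_cast; ring

/-- The Gaussian density and its space derivatives solve the heat equation. -/
theorem hasDerivAt_gaussDeriv_time {s : ℝ} (hs : 0 < s) (k : ℕ) (z : ℝ) :
    HasDerivAt (fun s => gaussDeriv k s z) (gaussDeriv (k + 2) s z / 2) s := by
  have hinv : ∀ c : ℝ, HasDerivAt (fun s : ℝ => c / s) (-(c / s ^ 2)) s := fun c =>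
    ((hasDerivAt_inv hs.ne').const_mul c).congr_fun_deriv (fun _ => div_eq_mul_inv _ _)
      (by ring)
  have h0 : HasDerivAt (fun s => gaussDeriv 0 s z) (gaussDeriv 2 s z / 2) s := by
    have hpos : 0 < 2 * Real.pi * s := by positivity
    have hlin : HasDerivAt (fun s : ℝ => 2 * Real.pi * s) (2 * Real.pi) s := by
      simpa using (hasDerivAt_id s).const_mul (2 * Real.pi)
    have hsq := (hlin.sqrt hpos.ne').inv (Real.sqrt_ne_zero'.2 hpos)
    have h : HasDerivAt (fun s : ℝ => -z ^ 2 / (2 * s)) (z ^ 2 / (2 * s ^ 2)) s :=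
      (hinv (-z ^ 2 / 2)).congr_fun_deriv (fun y => by rw [div_div]) (by ring)
    refine (hsq.mul h.exp).congr_fun_deriv
      (fun y => by rw [gaussDeriv, one_div]; rfl) ?_
    rw [gaussDeriv_add_two 0, gaussDeriv_one, gaussDeriv]
    simp only [Pi.inv_apply]
    rw [Real.sq_sqrt hpos.le]
    have := Real.sqrt_pos.2 hpos
    field_simp
    push_cast
    ring
  induction k using Nat.twoStepInduction with
  | zero => exact h0
  | one =>
    refine ((hinv z).neg.mul h0).congr_fun_deriv (fun y => gaussDeriv_one y z) ?_
    rw [gaussDeriv_add_two 1, gaussDeriv_add_two 0, gaussDeriv_one]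
    simp only [Pi.neg_apply]
    field_simp
    push_cast
    ring
  | more k ih1 ih2 =>
    refine (((hinv z).neg.mul ih2).sub ((hinv (k + 1)).mul ih1)).congr_fun_deriv
      (fun y => gaussDeriv_add_two k y z) ?_
    rw [gaussDeriv_add_two (k + 2)]
    simp only [Pi.neg_apply]
    have h3 : gaussDeriv (k + 1 + 2) s z = gaussDeriv (k + 2 + 1) s z := rfl
    rw [h3, gaussDeriv_add_two k]
    field_simp
    push_cast
    ring

theorem abs_gaussDeriv_le_pow {a : ℝ} (ha : 0 < a) (k : ℕ) : ∃ C : ℝ, 0 ≤ C ∧ ∀ s, a ≤ s →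
    ∀ z, |gaussDeriv k s z| ≤ C * (1 + |z|) ^ k * gaussDeriv 0 s z := by
  induction k using Nat.twoStepInduction with
  | zero =>
    refine ⟨1, zero_le_one, fun s hs z => ?_⟩
    rw [abs_of_pos (gaussDeriv_zero_pos (ha.trans_le hs) z)]; simp
  | one =>
    refine ⟨1 / a, by positivity, fun s hs z => ?_⟩
    have hp := gaussDeriv_zero_pos (ha.trans_le hs) z
    rw [gaussDeriv_one, abs_mul, abs_of_pos hp, abs_neg, abs_div, abs_of_pos (ha.trans_le hs)]
    gcongr
    rw [pow_one, div_mul_eq_mul_div, one_mul]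
    gcongr
    linarith
  | more k ih1 ih2 =>
    obtain ⟨C1, h1, H1⟩ := ih1
    obtain ⟨C2, h2, H2⟩ := ih2
    refine ⟨C2 / a + (k + 1) * C1 / a, by positivity, fun s hs z => ?_⟩
    have hp := gaussDeriv_zero_pos (ha.trans_le hs) z
    have hs0 := ha.trans_le hs
    have hz := abs_nonneg z
    rw [gaussDeriv_add_two]
    have e1 : |z / s| ≤ (1 + |z|) / a := by
      rw [abs_div, abs_of_pos hs0]; gcongr; linarith
    have e2 : |(k + 1 : ℝ) / s| ≤ (k + 1) / a := by
      rw [abs_of_pos (by positivity)]; gcongr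
    have e3 : (1 + |z|) ^ k ≤ (1 + |z|) ^ (k + 2) :=
      pow_le_pow_right₀ (by linarith) (by omega)
    calc |-(z / s) * gaussDeriv (k + 1) s z - (k + 1 : ℝ) / s * gaussDeriv k s z|
        ≤ |-(z / s) * gaussDeriv (k + 1) s z| + |(k + 1 : ℝ) / s * gaussDeriv k s z| := abs_sub _ _
      _ = |z / s| * |gaussDeriv (k + 1) s z| + |(k + 1 : ℝ) / s| * |gaussDeriv k s z| := by
          rw [abs_mul, abs_mul, abs_neg]
      _ ≤ (1 + |z|) / a * (C2 * (1 + |z|) ^ (k + 1) * gaussDeriv 0 s z)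
          + (k + 1) / a * (C1 * (1 + |z|) ^ (k + 2) * gaussDeriv 0 s z) := by
          refine add_le_add (mul_le_mul e1 (H2 s hs z) (abs_nonneg _) (by positivity))
            (mul_le_mul e2 ((H1 s hs z).trans ?_) (abs_nonneg _) (by positivity))
          gcongr
      _ = _ := by ring

theorem one_add_abs_pow_le_exp_sq {ε : ℝ} (hε : 0 < ε) (k : ℕ) (z : ℝ) :
    (1 + |z|) ^ k ≤ k.factorial * Real.exp (1 + 1 / (4 * ε)) * Real.exp (ε * z ^ 2) := by
  have h := Real.pow_div_factorial_le_exp (1 + |z|) (by positivity) k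
  rw [div_le_iff₀ (by positivity)] at h
  refine h.trans ?_
  rw [mul_assoc, ← Real.exp_add, mul_comm]
  refine mul_le_mul_of_nonneg_left (Real.exp_le_exp.2 ?_) (by positivity)
  have h2 : 0 ≤ ε * (|z| - 1 / (2 * ε)) ^ 2 := by positivity
  have h3 : ε * (|z| - 1 / (2 * ε)) ^ 2 = ε * z ^ 2 - |z| + 1 / (4 * ε) := by
    rw [← sq_abs z]; field_simp; ring
  linarith

theorem abs_gaussDeriv_le_exp {a ε : ℝ} (ha : 0 < a) (hε : 0 < ε) (k : ℕ) : ∃ C : ℝ, 0 ≤ C ∧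
    ∀ s, a ≤ s → ∀ z, |gaussDeriv k s z| ≤ C * (Real.exp (ε * z ^ 2) * gaussDeriv 0 s z) := by
  obtain ⟨C, hC, H⟩ := abs_gaussDeriv_le_pow ha k
  refine ⟨C * (k.factorial * Real.exp (1 + 1 / (4 * ε))), by positivity, fun s hs z => ?_⟩
  have hp := gaussDeriv_zero_pos (ha.trans_le hs) z
  calc _ ≤ _ := H s hs z
    _ ≤ C * (k.factorial * Real.exp (1 + 1 / (4 * ε)) * Real.exp (ε * z ^ 2)) *
        gaussDeriv 0 s z := by gcongr; exact one_add_abs_pow_le_exp_sq hε k z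
    _ = _ := by ring

/-- Raising the variance from `s` to `T > s` leaves room for a Gaussian factor. -/
theorem exp_mul_gauss_le {a b T s : ℝ} (ha : 0 < a) (hs : s ∈ Set.Icc a b) (hT : b < T) (z : ℝ) :
    Real.exp ((1 / b - 1 / T) / 2 * z ^ 2) * gaussDeriv 0 s z
      ≤ Real.sqrt (T / a) * gaussDeriv 0 T z := by
  have hs0 : 0 < s := ha.trans_le hs.1
  have hb0 : 0 < b := hs0.trans_le hs.2
  have hT0 : 0 < T := hb0.trans hT
  have e : Real.sqrt (T / a) * (1 / Real.sqrt (2 * Real.pi * T)) =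
      1 / Real.sqrt (2 * Real.pi * a) := by
    rw [← Real.sqrt_one, ← Real.sqrt_div zero_le_one, ← Real.sqrt_mul (by positivity),
      ← Real.sqrt_div zero_le_one]
    congr 1; field_simp
  rw [gaussDeriv, gaussDeriv, ← mul_assoc (Real.sqrt _), e, mul_left_comm, ← Real.exp_add]
  have h1 : (1 / b - 1 / T) / 2 * z ^ 2 + -z ^ 2 / (2 * s) ≤ -z ^ 2 / (2 * T) := by
    have : 1 / b ≤ 1 / s := one_div_le_one_div_of_le hs0 hs.2
    have h2 : -z ^ 2 / (2 * T) - ((1 / b - 1 / T) / 2 * z ^ 2 + -z ^ 2 / (2 * s))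
        = (1 / s - 1 / b) / 2 * z ^ 2 := by field_simp; ring
    have : 0 ≤ (1 / s - 1 / b) / 2 * z ^ 2 := by
      apply mul_nonneg _ (sq_nonneg z); linarith
    linarith
  gcongr
  exact hs.1

theorem gaussDeriv_zero_le {T : ℝ} (hT : 0 < T) (z : ℝ) :
    gaussDeriv 0 T z ≤ 1 / Real.sqrt (2 * Real.pi * T) := by
  rw [gaussDeriv]
  refine mul_le_of_le_one_right (by positivity) (Real.exp_le_one_iff.2 ?_)
  rw [neg_div]; exact neg_nonpos.2 (by positivity)

theorem continuous_gaussDeriv {s : ℝ} (hs : 0 < s) (k : ℕ) : Continuous (gaussDeriv k s) :=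
  continuous_iff_continuousAt.2 fun z => (hasDerivAt_gaussDeriv_space hs k z).continuousAt

theorem abs_gaussDeriv_le_const {a b : ℝ} (ha : 0 < a) (hab : a ≤ b) (k : ℕ) : ∃ C : ℝ, 0 ≤ C ∧
    ∀ s ∈ Set.Icc a b, ∀ z, |gaussDeriv k s z| ≤ C := by
  have hb0 : 0 < b := ha.trans_le hab
  have hε : 0 < (1 / b - 1 / (b + 1)) / 2 := by
    have : 1 / (b + 1) < 1 / b := one_div_lt_one_div_of_lt hb0 (by linarith)
    linarith
  obtain ⟨C, hC, H⟩ := abs_gaussDeriv_le_exp ha hε k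
  refine ⟨C * (Real.sqrt ((b + 1) / a) * (1 / Real.sqrt (2 * Real.pi * (b + 1)))), by positivity,
    fun s hs z => (H s hs.1 z).trans ?_⟩
  refine mul_le_mul_of_nonneg_left ?_ hC
  refine (exp_mul_gauss_le ha hs (lt_add_one b) z).trans ?_
  exact mul_le_mul_of_nonneg_left (gaussDeriv_zero_le (by linarith) z) (Real.sqrt_nonneg _)

/-! ### Derivatives of the density along the heat flow -/

/-- The `k`-th space derivative of the density `heatDensity f s`. -/
noncomputable def heatDeriv (f : ℝ → ℝ) (k : ℕ) (s x : ℝ) : ℝ :=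
  ∫ y, f y * gaussDeriv k s (x - y)

theorem heatDeriv_zero (f : ℝ → ℝ) (s x : ℝ) : heatDeriv f 0 s x = heatDensity f s x := by
  simp only [heatDeriv, heatDensity, gaussDeriv]

section HeatDeriv

variable {f : ℝ → ℝ}

theorem aestronglyMeasurable_mul_gaussDeriv (hf : Integrable f) {s : ℝ} (hs : 0 < s) (k : ℕ)
    (x : ℝ) : AEStronglyMeasurable (fun y => f y * gaussDeriv k s (x - y)) :=
  hf.aestronglyMeasurable.mul
    ((continuous_gaussDeriv hs k).comp (continuous_const.sub continuous_id)).aestronglyMeasurable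

theorem integrable_mul_gaussDeriv (hf : Integrable f) {s : ℝ} (hs : 0 < s) (k : ℕ) (x : ℝ) :
    Integrable fun y => f y * gaussDeriv k s (x - y) := by
  obtain ⟨C, -, H⟩ := abs_gaussDeriv_le_const hs le_rfl k
  refine (hf.norm.mul_const C).mono' (aestronglyMeasurable_mul_gaussDeriv hf hs k x)
    (ae_of_all _ fun y => ?_)
  rw [norm_mul]
  exact mul_le_mul_of_nonneg_left (H s ⟨le_rfl, le_rfl⟩ _) (norm_nonneg _)

theorem hasDerivAt_heatDeriv_space (hf : Integrable f) {s : ℝ} (hs : 0 < s) (k : ℕ) (x : ℝ) :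
    HasDerivAt (heatDeriv f k s) (heatDeriv f (k + 1) s x) x := by
  obtain ⟨C, -, H⟩ := abs_gaussDeriv_le_const hs le_rfl (k + 1)
  refine (hasDerivAt_integral_of_dominated_loc_of_deriv_le (s := Set.univ)
    (F := fun x y => f y * gaussDeriv k s (x - y))
    (F' := fun x y => f y * gaussDeriv (k + 1) s (x - y)) (bound := fun y => ‖f y‖ * C)
    univ_mem
    (Eventually.of_forall fun x => aestronglyMeasurable_mul_gaussDeriv hf hs k x)
    (integrable_mul_gaussDeriv hf hs k x) (aestronglyMeasurable_mul_gaussDeriv hf hs (k + 1) x)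
    (ae_of_all _ fun y x _ => ?_) (hf.norm.mul_const C) (ae_of_all _ fun y x _ => ?_)).2
  · rw [norm_mul]
    exact mul_le_mul_of_nonneg_left (H s ⟨le_rfl, le_rfl⟩ _) (norm_nonneg _)
  · exact ((hasDerivAt_gaussDeriv_space hs k (x - y)).comp_sub_const x y).const_mul (f y)

theorem hasDerivAt_heatDeriv_time (hf : Integrable f) {s : ℝ} (hs : 0 < s) (k : ℕ) (x : ℝ) :
    HasDerivAt (fun s => heatDeriv f k s x) (heatDeriv f (k + 2) s x / 2) s := by
  obtain ⟨C, -, H⟩ := abs_gaussDeriv_le_const (a := s / 2) (b := 2 * s) (by linarith)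
    (by linarith) (k + 2)
  have hmem : Set.Icc (s / 2) (2 * s) ∈ 𝓝 s := Icc_mem_nhds (by linarith) (by linarith)
  have hpos : ∀ᶠ r in 𝓝 s, 0 < r := lt_mem_nhds hs
  have h := (hasDerivAt_integral_of_dominated_loc_of_deriv_le (s := Set.Icc (s / 2) (2 * s))
    (F := fun r y => f y * gaussDeriv k r (x - y))
    (F' := fun r y => f y * (gaussDeriv (k + 2) r (x - y) / 2))
    (bound := fun y => ‖f y‖ * C) hmem
    (hpos.mono fun r hr => aestronglyMeasurable_mul_gaussDeriv hf hr k x)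
    (integrable_mul_gaussDeriv hf hs k x)
    (((aestronglyMeasurable_mul_gaussDeriv hf hs (k + 2) x).mul_const (1 / 2)).congr
      (ae_of_all _ fun y => by ring))
    (ae_of_all _ fun y r hr => ?_) (hf.norm.mul_const C) (ae_of_all _ fun y r hr => ?_)).2
  · refine h.congr_deriv ?_
    rw [heatDeriv, ← integral_div]
    exact integral_congr_ae (ae_of_all _ fun y => by ring)
  · rw [norm_mul]
    refine mul_le_mul_of_nonneg_left ?_ (norm_nonneg _)
    have h1 := H r hr (x - y)
    rw [norm_div, Real.norm_eq_abs, Real.norm_two]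
    linarith [abs_nonneg (gaussDeriv (k + 2) r (x - y))]
  · have hr0 : 0 < r := lt_of_lt_of_le (by linarith) hr.1
    exact (hasDerivAt_gaussDeriv_time hr0 k (x - y)).const_mul (f y)

theorem continuous_heatDeriv (hf : Integrable f) {s : ℝ} (hs : 0 < s) (k : ℕ) :
    Continuous (heatDeriv f k s) :=
  continuous_iff_continuousAt.2 fun x => (hasDerivAt_heatDeriv_space hf hs k x).continuousAt

theorem heatDeriv_zero_pos (hf : IsProbDensity f) {s : ℝ} (hs : 0 < s) (x : ℝ) :
    0 < heatDeriv f 0 s x := by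
  have hpos : ∀ y, 0 < gaussDeriv 0 s (x - y) := fun y => gaussDeriv_zero_pos hs _
  refine (integral_pos_iff_support_of_nonneg (fun y => mul_nonneg (hf.nonneg y) (hpos y).le)
    (integrable_mul_gaussDeriv hf.integrable hs 0 x)).2 ?_
  have h1 : 0 < ∫ y, f y := by rw [hf.integral_eq_one]; exact one_pos
  rw [integral_pos_iff_support_of_nonneg hf.nonneg hf.integrable] at h1
  convert h1 using 2
  ext y
  simp [(hpos y).ne']

theorem integrable_heatDeriv_zero (hf : Integrable f) {s : ℝ} (hs : 0 < s) :
    Integrable (heatDeriv f 0 s) := by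
  have hG : Integrable (gaussDeriv 0 s) := by
    have h := (integrable_exp_neg_mul_sq (b := 1 / (2 * s)) (by positivity)).const_mul
      (1 / Real.sqrt (2 * Real.pi * s))
    refine h.congr (ae_of_all _ fun z => ?_)
    simp only [gaussDeriv]
    congr 2
    ring
  exact hf.integrable_convolution (ContinuousLinearMap.mul ℝ ℝ) hG

/-- The space derivatives of the density at time `s` are controlled by the densities at time `s`
and at a later time `T`, with an arbitrarily small power `θ` of the latter. -/
theorem exists_abs_heatDeriv_le (hf : IsProbDensity f) {a b T θ : ℝ} (ha : 0 < a) (hab : a ≤ b)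
    (hT : b < T) (hθ : 0 < θ) (hθ1 : θ ≤ 1) (k : ℕ) : ∃ C : ℝ, 0 ≤ C ∧ ∀ s ∈ Set.Icc a b, ∀ x,
      |heatDeriv f k s x| ≤
        C * ((heatDeriv f 0 T x / heatDeriv f 0 s x) ^ θ * heatDeriv f 0 s x) := by
  have hb0 : 0 < b := ha.trans_le hab
  have hT0 : 0 < T := hb0.trans hT
  set δ := (1 / b - 1 / T) / 2 with hδ
  have hδ0 : 0 < δ := by
    have : 1 / T < 1 / b := one_div_lt_one_div_of_lt hb0 hT
    rw [hδ]; linarith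
  obtain ⟨C, hC, H⟩ := abs_gaussDeriv_le_exp ha (mul_pos hθ hδ0) k
  set M := Real.sqrt (T / a)
  have hM : 0 ≤ M := Real.sqrt_nonneg _
  refine ⟨C * ((1 - θ) + θ * M), mul_nonneg hC (by nlinarith), fun s hs x => ?_⟩
  have hs0 : 0 < s := ha.trans_le hs.1
  have hp := heatDeriv_zero_pos hf hs0 x
  have hP := heatDeriv_zero_pos hf hT0 x
  set p := heatDeriv f 0 s x with hpdef
  set P := heatDeriv f 0 T x with hPdef
  set c := P / p with hc
  have hc0 : 0 < c := div_pos hP hp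
  -- weighted arithmetic-geometric mean inequality, with the weights balanced at `c = P / p`
  have key : ∀ z, |gaussDeriv k s z| ≤
      C * ((1 - θ) * c ^ θ * gaussDeriv 0 s z + θ * c ^ (θ - 1) * M * gaussDeriv 0 T z) := by
    intro z
    have hG := gaussDeriv_zero_pos hs0 z
    refine (H s hs.1 z).trans (mul_le_mul_of_nonneg_left ?_ hC)
    have hamgm : Real.exp (θ * δ * z ^ 2) ≤
        (1 - θ) * c ^ θ + θ * c ^ (θ - 1) * Real.exp (δ * z ^ 2) := by
      have h := Real.geom_mean_le_arith_mean2_weighted (w₁ := 1 - θ) (w₂ := θ) (p₁ := c ^ θ)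
        (p₂ := c ^ (θ - 1) * Real.exp (δ * z ^ 2)) (by linarith) hθ.le (by positivity)
        (by positivity) (by ring)
      rw [Real.mul_rpow (by positivity) (by positivity), ← Real.rpow_mul hc0.le,
        ← Real.rpow_mul hc0.le, ← mul_assoc, ← Real.rpow_add hc0,
        show θ * (1 - θ) + (θ - 1) * θ = 0 by ring, Real.rpow_zero, one_mul, ← Real.exp_mul] at h
      calc _ = Real.exp (δ * z ^ 2 * θ) := by ring_nf
        _ ≤ _ := h
        _ = _ := by ring
    have h2 := exp_mul_gauss_le ha hs hT z
    calc _ ≤ ((1 - θ) * c ^ θ + θ * c ^ (θ - 1) * Real.exp (δ * z ^ 2)) * gaussDeriv 0 s z :=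
          mul_le_mul_of_nonneg_right hamgm hG.le
      _ = (1 - θ) * c ^ θ * gaussDeriv 0 s z +
          θ * c ^ (θ - 1) * (Real.exp (δ * z ^ 2) * gaussDeriv 0 s z) := by ring
      _ ≤ (1 - θ) * c ^ θ * gaussDeriv 0 s z +
          θ * c ^ (θ - 1) * (M * gaussDeriv 0 T z) := by gcongr
      _ = _ := by ring
  have hi1 := integrable_mul_gaussDeriv hf.integrable hs0 0 x
  have hi2 := integrable_mul_gaussDeriv hf.integrable hT0 0 x
  have hcp : c ^ (θ - 1) * P = c ^ θ * p := by
    rw [Real.rpow_sub_one hc0.ne', hc]; field_simp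
  calc |heatDeriv f k s x| ≤ ∫ y, |f y * gaussDeriv k s (x - y)| := abs_integral_le_integral_abs
    _ ≤ ∫ y, (C * ((1 - θ) * c ^ θ) * (f y * gaussDeriv 0 s (x - y)) +
          C * (θ * c ^ (θ - 1) * M) * (f y * gaussDeriv 0 T (x - y))) := by
        refine integral_mono (integrable_mul_gaussDeriv hf.integrable hs0 k x).abs
          ((hi1.const_mul _).add (hi2.const_mul _)) fun y => ?_
        have h := mul_le_mul_of_nonneg_left (key (x - y)) (hf.nonneg y)
        simp only [abs_mul, abs_of_nonneg (hf.nonneg y)]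
        exact h.trans_eq (by ring)
    _ = C * ((1 - θ) * c ^ θ) * p + C * (θ * c ^ (θ - 1) * M) * P := by
        rw [integral_add (hi1.const_mul _) (hi2.const_mul _), integral_const_mul,
          integral_const_mul]
        rfl
    _ = C * ((1 - θ) * (c ^ θ * p) + θ * M * (c ^ (θ - 1) * P)) := by ring
    _ = _ := by rw [hcp]; ring

theorem heatDeriv_zero_le (hf : IsProbDensity f) {a b T s : ℝ} (ha : 0 < a) (hs : s ∈ Set.Icc a b)
    (hT : b < T) (x : ℝ) :
    heatDeriv f 0 s x ≤ Real.sqrt (T / a) * heatDeriv f 0 T x := by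
  have hs0 : 0 < s := ha.trans_le hs.1
  have hb0 : 0 < b := hs0.trans_le hs.2
  have hT0 : 0 < T := hb0.trans hT
  rw [heatDeriv, heatDeriv, ← integral_const_mul]
  refine integral_mono (integrable_mul_gaussDeriv hf.integrable hs0 0 x)
    ((integrable_mul_gaussDeriv hf.integrable hT0 0 x).const_mul _) fun y => ?_
  have h := exp_mul_gauss_le ha hs hT (x - y)
  have h1 : 1 ≤ Real.exp ((1 / b - 1 / T) / 2 * (x - y) ^ 2) := by
    have : 1 / T < 1 / b := one_div_lt_one_div_of_lt hb0 hT
    exact Real.one_le_exp (mul_nonneg (by linarith) (sq_nonneg _))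
  have h2 : gaussDeriv 0 s (x - y) ≤ Real.sqrt (T / a) * gaussDeriv 0 T (x - y) :=
    (le_mul_of_one_le_left (gaussDeriv_zero_pos hs0 _).le h1).trans h
  exact (mul_le_mul_of_nonneg_left h2 (hf.nonneg y)).trans_eq (by ring)

end HeatDeriv

/-! ### Integrals of polynomials in the ratios of derivatives -/

/-- The sequence `k ↦ (∂ₓᵏ p / p)(s, x)` for the density `p(s, ·) = heatDensity f s`. -/
noncomputable def heatRatio (f : ℝ → ℝ) (s x : ℝ) (k : ℕ) : ℝ :=
  heatDeriv f k s x / heatDeriv f 0 s x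

/-- The space derivative on polynomials in the variables `vₖ = ∂ₓᵏ p / p`. -/
noncomputable def spaceDerivation : Derivation ℝ (MvPolynomial ℕ ℝ) (MvPolynomial ℕ ℝ) :=
  MvPolynomial.mkDerivation ℝ fun k =>
    MvPolynomial.X (k + 1) - MvPolynomial.X k * MvPolynomial.X 1

/-- Twice the time derivative on polynomials in the variables `vₖ = ∂ₓᵏ p / p`, when `p` solves
the heat equation `∂ₜ p = ∂ₓ² p / 2`. -/
noncomputable def timeDerivation : Derivation ℝ (MvPolynomial ℕ ℝ) (MvPolynomial ℕ ℝ) :=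
  MvPolynomial.mkDerivation ℝ fun k =>
    MvPolynomial.X (k + 2) - MvPolynomial.X k * MvPolynomial.X 2

/-- The operator `L` with `∂ₓ (p ^ α Q(v)) = p ^ α (L Q)(v)`. -/
noncomputable def spaceOp (α : ℝ) (Q : MvPolynomial ℕ ℝ) : MvPolynomial ℕ ℝ :=
  MvPolynomial.C α * MvPolynomial.X 1 * Q + spaceDerivation Q

/-- The operator `L` with `∂ₜ (p ^ α Q(v)) = p ^ α (L Q)(v) / 2`. -/
noncomputable def timeOp (α : ℝ) (Q : MvPolynomial ℕ ℝ) : MvPolynomial ℕ ℝ :=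
  MvPolynomial.C α * MvPolynomial.X 2 * Q + timeDerivation Q

/-- The functional `∫ p(s, x) ^ α Q(v(s, x)) dx`. -/
noncomputable def ratioIntegral (f : ℝ → ℝ) (α : ℝ) (Q : MvPolynomial ℕ ℝ) (s : ℝ) : ℝ :=
  ∫ x, heatDeriv f 0 s x ^ α * MvPolynomial.eval (heatRatio f s x) Q

theorem hasDerivAt_eval_derivation {u : ℝ → ℕ → ℝ}
    {D : Derivation ℝ (MvPolynomial ℕ ℝ) (MvPolynomial ℕ ℝ)} {x : ℝ}
    (h : ∀ k, HasDerivAt (fun x => u x k)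
      (MvPolynomial.eval (u x) (D (MvPolynomial.X k))) x) (Q : MvPolynomial ℕ ℝ) :
    HasDerivAt (fun x => MvPolynomial.eval (u x) Q) (MvPolynomial.eval (u x) (D Q)) x := by
  induction Q using MvPolynomial.induction_on with
  | C a =>
    rw [← MvPolynomial.algebraMap_eq, Derivation.map_algebraMap]
    simpa using hasDerivAt_const x a
  | add p q hp hq =>
    exact (hp.add hq).congr_fun_deriv (fun y => by simp) (by simp)
  | mul_X p n hp =>
    refine (hp.mul (h n)).congr_fun_deriv (fun y => by simp) ?_
    simp [Derivation.leibniz]; ring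

section Ratio

variable {f : ℝ → ℝ}

theorem hasDerivAt_heatRatio_space (hf : IsProbDensity f) {s : ℝ} (hs : 0 < s) (k : ℕ) (x : ℝ) :
    HasDerivAt (fun x => heatRatio f s x k)
      (heatRatio f s x (k + 1) - heatRatio f s x k * heatRatio f s x 1) x := by
  have hp := (heatDeriv_zero_pos hf hs x).ne'
  refine ((hasDerivAt_heatDeriv_space hf.integrable hs k x).div
    (hasDerivAt_heatDeriv_space hf.integrable hs 0 x) hp).congr_deriv ?_
  simp only [heatRatio, zero_add]
  field_simp

theorem hasDerivAt_heatRatio_time (hf : IsProbDensity f) {s : ℝ} (hs : 0 < s) (k : ℕ) (x : ℝ) :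
    HasDerivAt (fun s => heatRatio f s x k)
      ((heatRatio f s x (k + 2) - heatRatio f s x k * heatRatio f s x 2) / 2) s := by
  have hp := (heatDeriv_zero_pos hf hs x).ne'
  refine ((hasDerivAt_heatDeriv_time hf.integrable hs k x).div
    (hasDerivAt_heatDeriv_time hf.integrable hs 0 x) hp).congr_deriv ?_
  simp only [heatRatio, zero_add]
  field_simp

theorem hasDerivAt_eval_heatRatio_space (hf : IsProbDensity f) {s : ℝ} (hs : 0 < s)
    (Q : MvPolynomial ℕ ℝ) (x : ℝ) :
    HasDerivAt (fun x => MvPolynomial.eval (heatRatio f s x) Q)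
      (MvPolynomial.eval (heatRatio f s x) (spaceDerivation Q)) x := by
  refine hasDerivAt_eval_derivation (u := fun x => heatRatio f s x) (fun k => ?_) Q
  simpa [spaceDerivation, MvPolynomial.mkDerivation_X] using hasDerivAt_heatRatio_space hf hs k x

theorem hasDerivAt_eval_heatRatio_time (hf : IsProbDensity f) {s : ℝ} (hs : 0 < s)
    (Q : MvPolynomial ℕ ℝ) (x : ℝ) :
    HasDerivAt (fun s => MvPolynomial.eval (heatRatio f s x) Q)
      (MvPolynomial.eval (heatRatio f s x) (timeDerivation Q) / 2) s := by
  have h := hasDerivAt_eval_derivation (u := fun s => heatRatio f s x)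
    (D := (1 / 2 : ℝ) • timeDerivation) (x := s) (fun k => ?_) Q
  · refine h.congr_deriv ?_
    simp [MvPolynomial.smul_eval]; ring
  · refine (hasDerivAt_heatRatio_time hf hs k x).congr_deriv ?_
    simp [timeDerivation, MvPolynomial.mkDerivation_X, MvPolynomial.smul_eval]; ring

theorem hasDerivAt_rpow_mul_eval_space (hf : IsProbDensity f) {s : ℝ} (hs : 0 < s) (α : ℝ)
    (Q : MvPolynomial ℕ ℝ) (x : ℝ) :
    HasDerivAt (fun x => heatDeriv f 0 s x ^ α * MvPolynomial.eval (heatRatio f s x) Q)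
      (heatDeriv f 0 s x ^ α * MvPolynomial.eval (heatRatio f s x) (spaceOp α Q)) x := by
  have hp := heatDeriv_zero_pos hf hs x
  refine (((hasDerivAt_heatDeriv_space hf.integrable hs 0 x).rpow_const (p := α)
    (Or.inl hp.ne')).mul (hasDerivAt_eval_heatRatio_space hf hs Q x)).congr_deriv ?_
  simp only [spaceOp, map_add, map_mul, MvPolynomial.eval_C, MvPolynomial.eval_X,
    Real.rpow_sub_one hp.ne', zero_add]
  rw [show heatRatio f s x 1 = heatDeriv f 1 s x / heatDeriv f 0 s x from rfl]
  field_simp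

theorem hasDerivAt_rpow_mul_eval_time (hf : IsProbDensity f) {s : ℝ} (hs : 0 < s) (α : ℝ)
    (Q : MvPolynomial ℕ ℝ) (x : ℝ) :
    HasDerivAt (fun s => heatDeriv f 0 s x ^ α * MvPolynomial.eval (heatRatio f s x) Q)
      (heatDeriv f 0 s x ^ α * MvPolynomial.eval (heatRatio f s x) (timeOp α Q) / 2) s := by
  have hp := heatDeriv_zero_pos hf hs x
  refine (((hasDerivAt_heatDeriv_time hf.integrable hs 0 x).rpow_const (p := α)
    (Or.inl hp.ne')).mul (hasDerivAt_eval_heatRatio_time hf hs Q x)).congr_deriv ?_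
  simp only [timeOp, map_add, map_mul, MvPolynomial.eval_C, MvPolynomial.eval_X,
    Real.rpow_sub_one hp.ne', zero_add]
  rw [show heatRatio f s x 2 = heatDeriv f 2 s x / heatDeriv f 0 s x from rfl]
  field_simp

theorem continuous_rpow_mul_eval (hf : IsProbDensity f) {s : ℝ} (hs : 0 < s) (α : ℝ)
    (Q : MvPolynomial ℕ ℝ) :
    Continuous fun x => heatDeriv f 0 s x ^ α * MvPolynomial.eval (heatRatio f s x) Q :=
  continuous_iff_continuousAt.2 fun x =>
    (hasDerivAt_rpow_mul_eval_space hf hs α Q x).continuousAt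

/-- Polynomials in the ratios `∂ₓᵏ p / p` are bounded by arbitrarily small powers of `P / p`: a
product is estimated by splitting the exponent `θ` between its factors. -/
theorem exists_abs_eval_heatRatio_le (hf : IsProbDensity f) {a b T : ℝ} (ha : 0 < a)
    (hab : a ≤ b) (hT : b < T) (Q : MvPolynomial ℕ ℝ) {θ : ℝ} (hθ : 0 < θ) (hθ1 : θ ≤ 1) :
    ∃ C : ℝ, 0 ≤ C ∧ ∀ s ∈ Set.Icc a b, ∀ x,
      |MvPolynomial.eval (heatRatio f s x) Q| ≤
        C * (heatDeriv f 0 T x / heatDeriv f 0 s x) ^ θ := by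
  have hT0 : 0 < T := (ha.trans_le hab).trans hT
  have hpos : ∀ s ∈ Set.Icc a b, ∀ x, 0 < heatDeriv f 0 T x / heatDeriv f 0 s x :=
    fun s hs x => div_pos (heatDeriv_zero_pos hf hT0 x)
      (heatDeriv_zero_pos hf (ha.trans_le hs.1) x)
  induction Q using MvPolynomial.induction_on generalizing θ with
  | C c =>
    refine ⟨|c| * Real.sqrt (T / a) ^ θ, by positivity, fun s hs x => ?_⟩
    rw [MvPolynomial.eval_C, mul_assoc, ← Real.mul_rpow (Real.sqrt_nonneg _) (hpos s hs x).le]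
    refine le_mul_of_one_le_right (abs_nonneg _) (Real.one_le_rpow ?_ hθ.le)
    rw [mul_div_assoc', one_le_div (heatDeriv_zero_pos hf (ha.trans_le hs.1) x)]
    exact heatDeriv_zero_le hf ha hs hT x
  | add p q hp hq =>
    obtain ⟨C1, h1, H1⟩ := hp hθ hθ1
    obtain ⟨C2, h2, H2⟩ := hq hθ hθ1
    refine ⟨C1 + C2, by positivity, fun s hs x => ?_⟩
    rw [map_add, add_mul]
    exact (abs_add_le _ _).trans (add_le_add (H1 s hs x) (H2 s hs x))
  | mul_X p k hp =>
    obtain ⟨C1, h1, H1⟩ := hp (half_pos hθ) (by linarith)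
    obtain ⟨C2, h2, H2⟩ := exists_abs_heatDeriv_le hf ha hab hT (half_pos hθ) (by linarith) k
    refine ⟨C1 * C2, by positivity, fun s hs x => ?_⟩
    have hps := heatDeriv_zero_pos hf (ha.trans_le hs.1) x
    have h3 : |heatRatio f s x k| ≤
        C2 * (heatDeriv f 0 T x / heatDeriv f 0 s x) ^ (θ / 2) := by
      rw [heatRatio, abs_div, abs_of_pos hps, div_le_iff₀ hps, mul_assoc]
      exact H2 s hs x
    rw [map_mul, MvPolynomial.eval_X, abs_mul]
    refine (mul_le_mul (H1 s hs x) h3 (abs_nonneg _)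
      (mul_nonneg h1 (Real.rpow_nonneg (hpos s hs x).le _))).trans_eq ?_
    rw [mul_mul_mul_comm, ← Real.rpow_add (hpos s hs x), add_halves]

/-- Uniformly in time, `p ^ α Q(v)` is dominated by the `α`-th power of the density at any later
time. -/
theorem exists_abs_rpow_mul_eval_le (hf : IsProbDensity f) {a b T α : ℝ} (ha : 0 < a)
    (hab : a ≤ b) (hT : b < T) (hα : 1 / 2 ≤ α) (Q : MvPolynomial ℕ ℝ) :
    ∃ C : ℝ, 0 ≤ C ∧ ∀ s ∈ Set.Icc a b, ∀ x,
      |heatDeriv f 0 s x ^ α * MvPolynomial.eval (heatRatio f s x) Q| ≤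
        C * heatDeriv f 0 T x ^ α := by
  have hT0 : 0 < T := (ha.trans_le hab).trans hT
  obtain ⟨C, hC, H⟩ := exists_abs_eval_heatRatio_le hf ha hab hT Q (θ := 1 / 2) (by norm_num)
    (by norm_num)
  refine ⟨C * Real.sqrt (T / a) ^ (α - 1 / 2), by positivity, fun s hs x => ?_⟩
  have hp := heatDeriv_zero_pos hf (ha.trans_le hs.1) x
  have hP := heatDeriv_zero_pos hf hT0 x
  rw [abs_mul, abs_of_pos (Real.rpow_pos_of_pos hp α)]
  calc _ ≤ heatDeriv f 0 s x ^ α *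
        (C * (heatDeriv f 0 T x / heatDeriv f 0 s x) ^ (1 / 2 : ℝ)) := by
        gcongr; exact H s hs x
    _ = C * heatDeriv f 0 T x ^ (1 / 2 : ℝ) * heatDeriv f 0 s x ^ (α - 1 / 2) := by
        rw [Real.div_rpow hP.le hp.le, Real.rpow_sub hp]; ring
    _ ≤ C * heatDeriv f 0 T x ^ (1 / 2 : ℝ) *
        (Real.sqrt (T / a) * heatDeriv f 0 T x) ^ (α - 1 / 2) := by
        gcongr
        exact heatDeriv_zero_le hf ha hs hT x
    _ = C * Real.sqrt (T / a) ^ (α - 1 / 2) *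
        (heatDeriv f 0 T x ^ (1 / 2 : ℝ) * heatDeriv f 0 T x ^ (α - 1 / 2)) := by
        rw [Real.mul_rpow (Real.sqrt_nonneg _) hP.le]; ring
    _ = _ := by rw [← Real.rpow_add hP]; congr 2; ring

variable {α s T : ℝ}

theorem integrable_rpow_mul_eval (hf : IsProbDensity f) (hα : 1 / 2 ≤ α)
    (hint : Integrable fun x => heatDeriv f 0 T x ^ α) (hs : s ∈ Set.Ioo 0 T)
    (Q : MvPolynomial ℕ ℝ) :
    Integrable fun x => heatDeriv f 0 s x ^ α * MvPolynomial.eval (heatRatio f s x) Q := by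
  obtain ⟨C, -, H⟩ := exists_abs_rpow_mul_eval_le hf hs.1 le_rfl hs.2 hα Q
  exact (hint.const_mul C).mono' (continuous_rpow_mul_eval hf hs.1 α Q).aestronglyMeasurable
    (ae_of_all _ fun x => H s ⟨le_rfl, le_rfl⟩ x)

theorem ratioIntegral_add (hf : IsProbDensity f) (hα : 1 / 2 ≤ α)
    (hint : Integrable fun x => heatDeriv f 0 T x ^ α) (hs : s ∈ Set.Ioo 0 T)
    (Q R : MvPolynomial ℕ ℝ) :
    ratioIntegral f α (Q + R) s = ratioIntegral f α Q s + ratioIntegral f α R s := by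
  rw [ratioIntegral, ratioIntegral, ratioIntegral,
    ← integral_add (integrable_rpow_mul_eval hf hα hint hs Q)
      (integrable_rpow_mul_eval hf hα hint hs R)]
  simp only [map_add, mul_add]

/-- Integration by parts: total space derivatives integrate to zero. -/
theorem ratioIntegral_spaceOp (hf : IsProbDensity f) (hα : 1 / 2 ≤ α)
    (hint : Integrable fun x => heatDeriv f 0 T x ^ α) (hs : s ∈ Set.Ioo 0 T)
    (Q : MvPolynomial ℕ ℝ) : ratioIntegral f α (spaceOp α Q) s = 0 :=
  integral_eq_zero_of_hasDerivAt_of_integrable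
    (fun x => hasDerivAt_rpow_mul_eval_space hf hs.1 α Q x)
    (integrable_rpow_mul_eval hf hα hint hs (spaceOp α Q))
    (integrable_rpow_mul_eval hf hα hint hs Q)

theorem hasDerivAt_ratioIntegral (hf : IsProbDensity f) (hα : 1 / 2 ≤ α)
    (hint : Integrable fun x => heatDeriv f 0 T x ^ α) (hs : s ∈ Set.Ioo 0 T)
    (Q : MvPolynomial ℕ ℝ) :
    HasDerivAt (ratioIntegral f α Q) (ratioIntegral f α (timeOp α Q) s / 2) s := by
  have hs0 := hs.1
  have hsT := hs.2
  obtain ⟨C, -, H⟩ := exists_abs_rpow_mul_eval_le hf (a := s / 2) (b := (s + T) / 2) (T := T)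
    (by linarith) (by linarith) (by linarith) hα (timeOp α Q)
  have h := (hasDerivAt_integral_of_dominated_loc_of_deriv_le
    (s := Set.Icc (s / 2) ((s + T) / 2))
    (F := fun r x => heatDeriv f 0 r x ^ α * MvPolynomial.eval (heatRatio f r x) Q)
    (F' := fun r x =>
      heatDeriv f 0 r x ^ α * MvPolynomial.eval (heatRatio f r x) (timeOp α Q) / 2)
    (bound := fun x => C * heatDeriv f 0 T x ^ α)
    (Icc_mem_nhds (by linarith) (by linarith))
    ((lt_mem_nhds hs0).mono fun r hr => (continuous_rpow_mul_eval hf hr α Q).aestronglyMeasurable)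
    (integrable_rpow_mul_eval hf hα hint hs Q)
    ((continuous_rpow_mul_eval hf hs0 α (timeOp α Q)).div_const 2).aestronglyMeasurable
    (ae_of_all _ fun x r hr => ?_) (hint.const_mul C) (ae_of_all _ fun x r hr => ?_)).2
  · exact h.congr_deriv (integral_div _ _)
  · have h1 := H r hr x
    rw [norm_div, Real.norm_eq_abs, Real.norm_two]
    linarith [abs_nonneg
      (heatDeriv f 0 r x ^ α * MvPolynomial.eval (heatRatio f r x) (timeOp α Q))]
  · have hr0 : 0 < r := lt_of_lt_of_le (by linarith) hr.1
    exact hasDerivAt_rpow_mul_eval_time hf hr0 α Q x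

end Ratio

/-! ### Positivity of the quadratic form -/

theorem binary_nonneg {a b c : ℝ} (ha : 0 < a) (h : 0 ≤ a * c - b * b) (x y : ℝ) :
    0 ≤ a * x ^ 2 + 2 * b * x * y + c * y ^ 2 := by
  refine nonneg_of_mul_nonneg_right (?_ : 0 ≤ a * _) ha
  linear_combination sq_nonneg (a * x + b * y) + mul_nonneg h (sq_nonneg y)

theorem ternary_nonneg {a b c d e f : ℝ} (ha : 0 < a)
    (h : ∀ y z : ℝ, 0 ≤ (a * d - b * b) * y ^ 2 + 2 * (a * e - b * c) * y * z +
      (a * f - c * c) * z ^ 2) (x y z : ℝ) :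
    0 ≤ a * x ^ 2 + 2 * b * x * y + 2 * c * x * z + d * y ^ 2 + 2 * e * y * z + f * z ^ 2 := by
  refine nonneg_of_mul_nonneg_right (?_ : 0 ≤ a * _) ha
  linear_combination sq_nonneg (a * x + b * y + c * z) + h y z

theorem quaternary_nonneg {a b c d e f g k l m : ℝ} (ha : 0 < a)
    (h : ∀ y z w : ℝ, 0 ≤ (a * e - b * b) * y ^ 2 + 2 * (a * f - b * c) * y * z +
      2 * (a * g - b * d) * y * w + (a * k - c * c) * z ^ 2 + 2 * (a * l - c * d) * z * w +
      (a * m - d * d) * w ^ 2) (x y z w : ℝ) :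
    0 ≤ a * x ^ 2 + 2 * b * x * y + 2 * c * x * z + 2 * d * x * w + e * y ^ 2 + 2 * f * y * z +
      2 * g * y * w + k * z ^ 2 + 2 * l * z * w + m * w ^ 2 := by
  refine nonneg_of_mul_nonneg_right (?_ : 0 ≤ a * _) ha
  linear_combination sq_nonneg (a * x + b * y + c * z + d * w) + h y z w

/-- Lagrange's reduction of a quadratic form with positive leading coefficient: up to this
coefficient, it is a square plus the Schur complement, a form in one variable less. -/
theorem quinary_nonneg {a b c d e b₂ c₂ d₂ e₂ c₃ d₃ e₃ d₄ e₄ e₅ : ℝ} (ha : 0 < a)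
    (h : ∀ y z w v : ℝ, 0 ≤ (a * b₂ - b * b) * y ^ 2 + 2 * (a * c₂ - b * c) * y * z +
      2 * (a * d₂ - b * d) * y * w + 2 * (a * e₂ - b * e) * y * v + (a * c₃ - c * c) * z ^ 2 +
      2 * (a * d₃ - c * d) * z * w + 2 * (a * e₃ - c * e) * z * v + (a * d₄ - d * d) * w ^ 2 +
      2 * (a * e₄ - d * e) * w * v + (a * e₅ - e * e) * v ^ 2) (x y z w v : ℝ) :
    0 ≤ a * x ^ 2 + 2 * b * x * y + 2 * c * x * z + 2 * d * x * w + 2 * e * x * v + b₂ * y ^ 2 +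
      2 * c₂ * y * z + 2 * d₂ * y * w + 2 * e₂ * y * v + c₃ * z ^ 2 + 2 * d₃ * z * w +
      2 * e₃ * z * v + d₄ * w ^ 2 + 2 * e₄ * w * v + e₅ * v ^ 2 := by
  refine nonneg_of_mul_nonneg_right (?_ : 0 ≤ a * _) ha
  linear_combination sq_nonneg (a * x + b * y + c * z + d * w + e * v) + h y z w v

/-- The sum of `timeOp (2 - β)` of `thirdPoly β` and `spaceOp (2 - β)` of `boundaryPoly` is
`-(8 u ^ 2 + β * remainderForm)`, where `p, q, r, u` stand for `v₁, v₂, v₃, v₄`. -/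
noncomputable def remainderForm (β c₁ c₂ c₃ c₄ c₅ c₆ c₇ p q r u : ℝ) : ℝ :=
  -((β + 1) * (β + 2) + c₃) * p ^ 4 * u + (9 * (β + 1) - c₂) * p ^ 2 * q * u -
  (8 + 2 * c₁) * p * r * u - (14 - c₁ / 2) * q ^ 2 * u +
  ((β + 1) * (c₁ - 3) - c₂) * p ^ 2 * r ^ 2 +
  ((β + 1) * (2 - c₁ / 2) - 2 * c₂ - 3 * c₄) * p * q ^ 2 * r +
  ((β + 2) * (β + 1 + c₂) - 4 * c₃ - 2 * c₅) * p ^ 3 * q * r +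
  ((β + 3) * c₃ - c₆) * p ^ 5 * r + (2 * (β + 1) - c₄) * q ^ 4 +
  ((β + 2) * (c₄ - β - 1) - 3 * c₅) * p ^ 2 * q ^ 3 + ((β + 3) * c₅ - 5 * c₆) * p ^ 4 * q ^ 2 +
  ((β + 4) * c₆ - 7 * c₇) * p ^ 6 * q + (β + 5) * c₇ * p ^ 8

/-- On `[l, m] = [0, 4/5]` the coefficients `cᵢ` are affine in `β`, so that the form divided by `β`
is quadratic in `β`, apart from the term `8 u ^ 2 / β`. The latter is at least its tangent
`8 (2 τ - β) / τ ^ 2 * u ^ 2` at `τ = 7/10`; the resulting quadratic polynomial in `β` has positive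
definite coefficients in the Bernstein basis `(m - β) ^ 2`, `2 (m - β) (β - l)`, `(β - l) ^ 2`.
These are, up to scaling, the forms `h0`, `h1`, `h2`. -/
theorem remainderForm_nonneg_of_le {β : ℝ} (h₁ : 0 ≤ β) (h₂ : β ≤ 4 / 5)
    (p q r u : ℝ) : 0 ≤ 8 * u ^ 2 + β * remainderForm β
      (37 / 6 - 25 / 12 * β) (-7 / 2 - 25 / 12 * β) (-7 / 6 + 29 / 12 * β) (1 / 2 - 2 / 3 * β)
      (13 / 12 + 2 * β) (-7 / 12 - 5 / 6 * β) (5 / 12 - 1 / 6 * β) p q r u := by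
  have h0 : ∀ a b c d e : ℝ,
      0 ≤ 3840 * a ^ 2 + 2 * (-1708) * a * b + 2 * (-917) * a * c + 2 * 1050 * a * d +
      2 * (-70) * a * e + 1120 * b ^ 2 + 2 * 371 * b * c + 2 * (-210) * b * d +
      2 * (-245) * b * e + 252 * c ^ 2 + 2 * (-357) * c * d + 2 * 91 * c * e + 854 * d ^ 2 +
      2 * (-441) * d * e + 350 * e ^ 2 :=
    quinary_nonneg (by norm_num) <| quaternary_nonneg (by norm_num) <|
      ternary_nonneg (by norm_num) <| binary_nonneg (by norm_num) (by norm_num)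
  have h1 : ∀ a b c d e : ℝ,
      0 ≤ 96000 * a ^ 2 + 2 * (-54880) * a * b + 2 * (-33320) * a * c + 2 * 49784 * a * d +
      2 * (-8820) * a * e + 46648 * b ^ 2 + 2 * 20188 * b * c + 2 * (-28910) * b * d +
      2 * (-441) * b * e + 15092 * c ^ 2 + 2 * (-24059) * c * d + 2 * 5341 * c * e +
      52038 * d ^ 2 + 2 * (-18669) * d * e + 11270 * e ^ 2 :=
    quinary_nonneg (by norm_num) <| quaternary_nonneg (by norm_num) <|
      ternary_nonneg (by norm_num) <| binary_nonneg (by norm_num) (by norm_num)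
  have h2 : ∀ a b c d e : ℝ,
      0 ≤ 288000 * a ^ 2 + 2 * (-249900) * a * b + 2 * (-172725) * a * c + 2 * 314090 * a * d +
      2 * (-85358) * a * e + 231280 * b ^ 2 + 2 * 146755 * b * c + 2 * (-262542) * b * d +
      2 * 61201 * b * e + 106820 * c ^ 2 + 2 * (-193795) * c * d + 2 * 56301 * c * e +
      370930 * d ^ 2 + 2 * (-117355) * d * e + 48314 * e ^ 2 :=
    quinary_nonneg (by norm_num) <| quaternary_nonneg (by norm_num) <|
      ternary_nonneg (by norm_num) <| binary_nonneg (by norm_num) (by norm_num)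
  have h₄ : 0 ≤ 4 / 5 - β := by linarith
  have k0 := mul_nonneg (mul_nonneg h₁ (sq_nonneg (4 / 5 - β))) <|
    h0 u (p * r) (q ^ 2) (p ^ 2 * q) (p ^ 4)
  have k1 := mul_nonneg (mul_nonneg h₁ (mul_nonneg h₄ h₁)) <|
    h1 u (p * r) (q ^ 2) (p ^ 2 * q) (p ^ 4)
  have k2 := mul_nonneg (mul_nonneg h₁ (sq_nonneg β)) <|
    h2 u (p * r) (q ^ 2) (p ^ 2 * q) (p ^ 4)
  -- the error of the tangent: `1 - β (2 τ - β) / τ ^ 2 = (τ - β) ^ 2 / τ ^ 2`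
  have k3 := mul_nonneg (sq_nonneg (7 / 10 - β)) (sq_nonneg u)
  unfold remainderForm
  linear_combination 25 / 2688 * k0 + 5 / 9408 * k1 + 1 / 18816 * k2 + 800 / 49 * k3

/-- The analogue of `remainderForm_nonneg_of_le` on `[4/5, 107/100]`, with the tangent taken at
`τ = 26/25`. -/
theorem remainderForm_nonneg_of_ge {β : ℝ} (h₁ : 4 / 5 ≤ β) (h₂ : β ≤ 107 / 100)
    (p q r u : ℝ) : 0 ≤ 8 * u ^ 2 + β * remainderForm β
      (4621 / 500 - 771 / 250 * β) (-3499 / 500 - 329 / 250 * β) (-537 / 500 + 301 / 100 * β)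
      (879 / 500 - 793 / 500 * β) (367 / 500 + 903 / 250 * β) (193 / 500 - 1343 / 500 * β)
      (43 / 125 + 29 / 500 * β) p q r u := by
  have h0 : ∀ a b c d e : ℝ,
      0 ≤ 80000000 * a ^ 2 + 2 * (-91047060) * a * b + 2 * (-44838235) * a * c +
      2 * 102459630 * a * d + 2 * (-26930150) * a * e + 125443968 * b ^ 2 +
      2 * 51277473 * b * c + 2 * (-127110984) * b * d + 2 * 28865200 * b * e +
      26286260 * c ^ 2 + 2 * (-61435894) * c * d + 2 * 17623658 * c * e + 155584780 * d ^ 2 +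
      2 * (-47295664) * d * e + 19133504 * e ^ 2 :=
    quinary_nonneg (by norm_num) <| quaternary_nonneg (by norm_num) <|
      ternary_nonneg (by norm_num) <| binary_nonneg (by norm_num) (by norm_num)
  have h1 : ∀ a b c d e : ℝ,
      0 ≤ 2862500000 * a ^ 2 + 2 * (-3501159480) * a * b + 2 * (-1828710130) * a * c +
      2 * 4333744740 * a * d + 2 * (-1250828150) * a * e + 4996750668 * b ^ 2 +
      2 * 2251373553 * b * c + 2 * (-5686746234) * b * d + 2 * 1507282270 * b * e +
      1215079580 * c ^ 2 + 2 * (-2899763854) * c * d + 2 * 863081648 * c * e +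
      7311575440 * d ^ 2 + 2 * (-2235456964) * d * e + 798504044 * e ^ 2 :=
    quinary_nonneg (by norm_num) <| quaternary_nonneg (by norm_num) <|
      ternary_nonneg (by norm_num) <| binary_nonneg (by norm_num) (by norm_num)
  have h2 : ∀ a b c d e : ℝ,
      0 ≤ 12625000000 * a ^ 2 + 2 * (-16802182800) * a * b + 2 * (-9319454300) * a * c +
      2 * 22845521400 * a * d + 2 * (-7183852000) * a * e + 24498761196 * b ^ 2 +
      2 * 12353228901 * b * c + 2 * (-31464731298) * b * d + 2 * 9485200205 * b * e +
      6893543800 * c ^ 2 + 2 * (-16869758633) * c * d + 2 * 5328585886 * c * e +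
      41998798400 * d ^ 2 + 2 * (-13060895783) * d * e + 4165485298 * e ^ 2 :=
    quinary_nonneg (by norm_num) <| quaternary_nonneg (by norm_num) <|
      ternary_nonneg (by norm_num) <| binary_nonneg (by norm_num) (by norm_num)
  have hβ : 0 ≤ β := by linarith
  have h₃ : 0 ≤ β - 4 / 5 := by linarith
  have h₄ : 0 ≤ 107 / 100 - β := by linarith
  have k0 := mul_nonneg (mul_nonneg hβ (sq_nonneg (107 / 100 - β))) <|
    h0 u (p * r) (q ^ 2) (p ^ 2 * q) (p ^ 4)
  have k1 := mul_nonneg (mul_nonneg hβ (mul_nonneg h₄ h₃)) <|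
    h1 u (p * r) (q ^ 2) (p ^ 2 * q) (p ^ 4)
  have k2 := mul_nonneg (mul_nonneg hβ (sq_nonneg (β - 4 / 5))) <|
    h2 u (p * r) (q ^ 2) (p ^ 2 * q) (p ^ 4)
  -- the error of the tangent: `1 - β (2 τ - β) / τ ^ 2 = (τ - β) ^ 2 / τ ^ 2`
  have k3 := mul_nonneg (sq_nonneg (26 / 25 - β)) (sq_nonneg u)
  unfold remainderForm
  linear_combination 1 / 616005 * k0 + 1 / 12320100 * k1 + 1 / 123201000 * k2 + 1250 / 169 * k3

/-! ### Reduction of the integrands by integration by parts -/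

section Operators

open MvPolynomial

/-- The integrand of the second time derivative, up to a constant: `v₁ ^ 2` after one application of
`timeOp (2 - β)` and an integration by parts that removes `v₃`. -/
noncomputable def secondPoly (β : ℝ) : MvPolynomial ℕ ℝ :=
  C (-2) * X 2 ^ 2 + C β * X 1 ^ 2 * X 2

/-- The integrand of the third time derivative, up to a constant: `timeOp (2 - β)` of `secondPoly β`
after an integration by parts that removes `v₄`. -/
noncomputable def thirdPoly (β : ℝ) : MvPolynomial ℕ ℝ :=
  C 4 * X 3 ^ 2 + C (2 * β) * X 2 ^ 3 - C (4 * β) * X 1 * X 2 * X 3 -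
    C (β * (β + 1)) * X 1 ^ 2 * X 2 ^ 2 + C (β * (β + 1)) * X 1 ^ 3 * X 3

theorem timeOp_firstPoly (β : ℝ) : timeOp (2 - β) (X 1 ^ 2) =
    secondPoly β + spaceOp (2 - β) (C 2 * X 1 * X 2) := by
  refine MvPolynomial.funext fun v => ?_
  simp [timeOp, spaceOp, timeDerivation, spaceDerivation, secondPoly, Derivation.leibniz,
    Derivation.leibniz_pow, mkDerivation_X]
  ring

theorem timeOp_secondPoly (β : ℝ) : timeOp (2 - β) (secondPoly β) =
    thirdPoly β + spaceOp (2 - β) (C β * X 1 ^ 2 * X 3 - C 4 * X 2 * X 3) := by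
  refine MvPolynomial.funext fun v => ?_
  simp [timeOp, spaceOp, timeDerivation, spaceDerivation, secondPoly, thirdPoly,
    Derivation.leibniz, Derivation.leibniz_pow, mkDerivation_X]
  ring

/-- The boundary term of the integration by parts in the fourth derivative. The first three
monomials remove `v₅`; the others, with parameters `cᵢ`, run through the monomials in `v₁, v₂, v₃`
of the right weight. The coefficient `4 - c₁ / 2` makes `v₂ v₃ ^ 2`, which no product of two of the
monomials `v₄`, `v₁ v₃`, `v₂ ^ 2`, `v₁ ^ 2 v₂`, `v₁ ^ 4` produces, cancel. The parameters enter
with a factor `β` because, once `v₅` is removed, the form is `8 v₄ ^ 2` plus a multiple of `β`. -/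
noncomputable def boundaryPoly (β c₁ c₂ c₃ c₄ c₅ c₆ c₇ : ℝ) : MvPolynomial ℕ ℝ :=
  C (-8) * X 3 * X 4 + C (4 * β) * X 1 * X 2 * X 4 - C (β * (β + 1)) * X 1 ^ 3 * X 4 +
  C (β * c₁) * X 1 * X 3 ^ 2 + C (β * (4 - c₁ / 2)) * X 2 ^ 2 * X 3 +
  C (β * c₂) * X 1 ^ 2 * X 2 * X 3 + C (β * c₃) * X 1 ^ 4 * X 3 + C (β * c₄) * X 1 * X 2 ^ 3 +
  C (β * c₅) * X 1 ^ 3 * X 2 ^ 2 + C (β * c₆) * X 1 ^ 5 * X 2 + C (β * c₇) * X 1 ^ 7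

theorem eval_timeOp_thirdPoly_add (β c₁ c₂ c₃ c₄ c₅ c₆ c₇ : ℝ) (v : ℕ → ℝ) :
    eval v (timeOp (2 - β) (thirdPoly β) +
      spaceOp (2 - β) (boundaryPoly β c₁ c₂ c₃ c₄ c₅ c₆ c₇)) =
    -(8 * v 4 ^ 2 + β * remainderForm β c₁ c₂ c₃ c₄ c₅ c₆ c₇ (v 1) (v 2) (v 3) (v 4)) := by
  simp [timeOp, spaceOp, timeDerivation, spaceDerivation, boundaryPoly, thirdPoly,
    Derivation.leibniz, Derivation.leibniz_pow, mkDerivation_X, remainderForm]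
  ring

/-- Up to a total space derivative, the integrand of the fourth time derivative is nonpositive. -/
theorem exists_eval_timeOp_thirdPoly_nonpos {β : ℝ} (h₁ : 0 ≤ β) (h₂ : β ≤ 107 / 100) :
    ∃ W : MvPolynomial ℕ ℝ, ∀ v : ℕ → ℝ,
      eval v (timeOp (2 - β) (thirdPoly β) + spaceOp (2 - β) W) ≤ 0 := by
  rcases le_total β (4 / 5) with h | h
  · exact ⟨_, fun v => (eval_timeOp_thirdPoly_add β _ _ _ _ _ _ _ v).trans_le
      (neg_nonpos.2 (remainderForm_nonneg_of_le h₁ h _ _ _ _))⟩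
  · exact ⟨_, fun v => (eval_timeOp_thirdPoly_add β _ _ _ _ _ _ _ v).trans_le
      (neg_nonpos.2 (remainderForm_nonneg_of_ge h h₂ _ _ _ _))⟩

end Operators

/-! ### Differentiation of the entropy -/

section Entropy

variable {f : ℝ → ℝ} {α s T : ℝ}

theorem ratioIntegral_C_mul (c : ℝ) (Q : MvPolynomial ℕ ℝ) :
    ratioIntegral f α (MvPolynomial.C c * Q) s = c * ratioIntegral f α Q s := by
  rw [ratioIntegral, ratioIntegral, ← integral_const_mul]
  simp only [map_mul, MvPolynomial.eval_C]
  exact integral_congr_ae (ae_of_all _ fun x => by ring)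

/-- Logarithmic factors are absorbed by the small power of `P / p` that is available in
`exists_abs_heatDeriv_le`. -/
theorem exists_abs_heatDeriv_mul_log_le (hf : IsProbDensity f) {a b : ℝ} (ha : 0 < a)
    (hab : a ≤ b) (hT : b < T) (k : ℕ) : ∃ C : ℝ, ∀ s ∈ Set.Icc a b, ∀ x,
      |heatDeriv f k s x * Real.log (heatDeriv f 0 s x)| ≤
        C * (|Real.negMulLog (heatDeriv f 0 T x)| + heatDeriv f 0 T x) := by
  have hT0 : 0 < T := (ha.trans_le hab).trans hT
  obtain ⟨C, hC, H⟩ := exists_abs_heatDeriv_le hf ha hab hT (θ := 1 / 2) (by norm_num)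
    (by norm_num) k
  set N := Real.sqrt (Real.sqrt (T / a))
  have hN : 0 ≤ N := Real.sqrt_nonneg _
  obtain ⟨K, hK⟩ := (isCompact_Icc (a := (0 : ℝ)) (b := N)).exists_bound_of_continuousOn
    Real.continuous_mul_log.continuousOn
  have hK0 : 0 ≤ K := (norm_nonneg _).trans (hK 0 ⟨le_rfl, hN⟩)
  refine ⟨C * (N + 2 * K), fun s hs x => ?_⟩
  have hp := heatDeriv_zero_pos hf (ha.trans_le hs.1) x
  have hP := heatDeriv_zero_pos hf hT0 x
  have hH := H s hs x
  have hle := heatDeriv_zero_le hf ha hs hT x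
  generalize heatDeriv f 0 s x = p at *
  generalize heatDeriv f 0 T x = P at *
  generalize heatDeriv f k s x = g at *
  -- with `y ^ 2 = p / P`, the factor `log p` costs `log P` and `2 log y`, and `y log y` is bounded
  set y := Real.sqrt (p / P) with hy
  have hy0 : 0 < y := Real.sqrt_pos.2 (div_pos hp hP)
  have hyN : y ≤ N := Real.sqrt_le_sqrt ((div_le_iff₀ hP).2 hle)
  have hpy : p = P * y ^ 2 := by
    rw [hy, Real.sq_sqrt (div_pos hp hP).le]; field_simp
  have hg : |g| ≤ C * (P * y) := by
    refine hH.trans_eq ?_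
    rw [← Real.sqrt_eq_rpow, hpy, show P / (P * y ^ 2) = (y⁻¹) ^ 2 by field_simp,
      Real.sqrt_sq (inv_nonneg.2 hy0.le)]
    field_simp
  have hlog : |Real.log p| ≤ |Real.log P| + 2 * |Real.log y| := by
    rw [hpy, Real.log_mul hP.ne' (by positivity), Real.log_pow]
    refine (abs_add_le _ _).trans_eq ?_
    rw [abs_mul]; norm_num
  have hKy : y * |Real.log y| ≤ K := by
    have := hK y ⟨hy0.le, hyN⟩
    rwa [norm_mul, Real.norm_of_nonneg hy0.le] at this
  have hneg : |Real.negMulLog P| = P * |Real.log P| := by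
    rw [Real.negMulLog, neg_mul, abs_neg, abs_mul, abs_of_pos hP]
  rw [abs_mul, hneg]
  calc |g| * |Real.log p| ≤ C * (P * y) * (|Real.log P| + 2 * |Real.log y|) := by gcongr
    _ = C * (y * (P * |Real.log P|) + 2 * (y * |Real.log y|) * P) := by ring
    _ ≤ C * (N * (P * |Real.log P|) + 2 * K * P) := by gcongr
    _ ≤ C * (N + 2 * K) * (P * |Real.log P| + P) := by
      have h1 : 0 ≤ P * |Real.log P| := by positivity
      have h2 : 0 ≤ C * (2 * K * (P * |Real.log P|) + N * P) := by positivity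
      linear_combination h2

theorem integrable_heatDeriv_mul_log (hf : IsProbDensity f)
    (hint : Integrable fun x => Real.negMulLog (heatDeriv f 0 T x)) (hs : s ∈ Set.Ioo 0 T)
    (k : ℕ) : Integrable fun x => heatDeriv f k s x * Real.log (heatDeriv f 0 s x) := by
  obtain ⟨C, H⟩ := exists_abs_heatDeriv_mul_log_le hf hs.1 le_rfl hs.2 k
  refine (((hint.abs).add (integrable_heatDeriv_zero hf.integrable
    (hs.1.trans hs.2))).const_mul C).mono' ?_ (ae_of_all _ fun x => H s ⟨le_rfl, le_rfl⟩ x)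
  exact ((continuous_heatDeriv hf.integrable hs.1 k).mul
    ((continuous_heatDeriv hf.integrable hs.1 0).log
      fun x => (heatDeriv_zero_pos hf hs.1 x).ne')).aestronglyMeasurable

theorem integrable_heatDeriv (hf : IsProbDensity f) (hs : 0 < s) (k : ℕ) :
    Integrable (heatDeriv f k s) := by
  obtain ⟨C, -, H⟩ := exists_abs_heatDeriv_le hf hs le_rfl (lt_add_one s) one_pos le_rfl k
  refine ((integrable_heatDeriv_zero hf.integrable (by linarith : 0 < s + 1)).const_mul C).mono'
    (continuous_heatDeriv hf.integrable hs k).aestronglyMeasurable (ae_of_all _ fun x => ?_)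
  refine (H s ⟨le_rfl, le_rfl⟩ x).trans_eq ?_
  rw [Real.rpow_one, div_mul_cancel₀ _ (heatDeriv_zero_pos hf hs x).ne']

/-- De Bruijn's identity in integrated form: integration by parts turns the time derivative of
the Shannon entropy into the Fisher information. -/
theorem integral_log_mul_heatDeriv_two (hf : IsProbDensity f)
    (hint : Integrable fun x => Real.negMulLog (heatDeriv f 0 T x)) (hs : s ∈ Set.Ioo 0 T) :
    ∫ x, (-Real.log (heatDeriv f 0 s x) - 1) * heatDeriv f 2 s x =
      ratioIntegral f 1 (MvPolynomial.X 1 ^ 2) s := by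
  have hT0 : 0 < T := hs.1.trans hs.2
  have hint1 : Integrable fun x => heatDeriv f 0 T x ^ (1 : ℝ) := by
    simpa using integrable_heatDeriv_zero hf.integrable hT0
  have hI : ∀ k, Integrable fun x => (-Real.log (heatDeriv f 0 s x) - 1) * heatDeriv f k s x :=
    fun k => ((integrable_heatDeriv_mul_log hf hint hs k).neg.sub
      (integrable_heatDeriv hf hs.1 k)).congr (ae_of_all _ fun x => by
        simp only [Pi.sub_apply, Pi.neg_apply]; ring)
  have hF := integrable_rpow_mul_eval hf (by norm_num) hint1 hs (MvPolynomial.X 1 ^ 2)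
  have hd : ∀ x, HasDerivAt (fun x => (-Real.log (heatDeriv f 0 s x) - 1) * heatDeriv f 1 s x)
      ((-Real.log (heatDeriv f 0 s x) - 1) * heatDeriv f 2 s x - heatDeriv f 0 s x ^ (1 : ℝ) *
        MvPolynomial.eval (heatRatio f s x) (MvPolynomial.X 1 ^ 2)) x := by
    intro x
    have hp := heatDeriv_zero_pos hf hs.1 x
    refine ((((hasDerivAt_heatDeriv_space hf.integrable hs.1 0 x).log hp.ne').neg.sub_const
      1).mul (hasDerivAt_heatDeriv_space hf.integrable hs.1 1 x)).congr_deriv ?_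
    simp only [map_pow, MvPolynomial.eval_X, heatRatio, Real.rpow_one, zero_add, Pi.neg_apply]
    field_simp
    ring
  have h := integral_eq_zero_of_hasDerivAt_of_integrable hd ((hI 2).sub hF) (hI 1)
  rw [integral_sub (hI 2) hF] at h
  exact sub_eq_zero.1 h

theorem hasDerivAt_shannonEntropy (hf : IsProbDensity f)
    (hint : Integrable fun x => Real.negMulLog (heatDeriv f 0 T x)) (hs : s ∈ Set.Ioo 0 T) :
    HasDerivAt (fun s => ∫ x, Real.negMulLog (heatDeriv f 0 s x))
      (1 / 2 * ratioIntegral f 1 (MvPolynomial.X 1 ^ 2) s) s := by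
  have hs0 := hs.1
  have hsT := hs.2
  have hT0 := hs0.trans hsT
  have ha : 0 < s / 2 := by linarith
  have hab : s / 2 ≤ (s + T) / 2 := by linarith
  have hbT : (s + T) / 2 < T := by linarith
  obtain ⟨C₁, H₁⟩ := exists_abs_heatDeriv_mul_log_le hf ha hab hbT 2
  obtain ⟨C₂, -, H₂⟩ := exists_abs_heatDeriv_le hf ha hab hbT one_pos le_rfl 2
  have hPint := integrable_heatDeriv_zero hf.integrable hT0
  have hcont : ∀ r, 0 < r → Continuous fun x => Real.log (heatDeriv f 0 r x) := fun r hr =>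
    (continuous_heatDeriv hf.integrable hr 0).log fun x => (heatDeriv_zero_pos hf hr x).ne'
  have h := (hasDerivAt_integral_of_dominated_loc_of_deriv_le
    (s := Set.Icc (s / 2) ((s + T) / 2))
    (F := fun r x => Real.negMulLog (heatDeriv f 0 r x))
    (F' := fun r x => (-Real.log (heatDeriv f 0 r x) - 1) * heatDeriv f 2 r x / 2)
    (bound := fun x => C₁ * (|Real.negMulLog (heatDeriv f 0 T x)| + heatDeriv f 0 T x) +
      C₂ * heatDeriv f 0 T x)
    (Icc_mem_nhds (by linarith) (by linarith))
    ((lt_mem_nhds hs0).mono fun r hr => (Real.continuous_negMulLog.comp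
      (continuous_heatDeriv hf.integrable hr 0)).aestronglyMeasurable)
    ((integrable_heatDeriv_mul_log hf hint hs 0).neg.congr (ae_of_all _ fun x => by
      simp only [Pi.neg_apply, Real.negMulLog]; ring))
    ((((hcont s hs0).neg.sub continuous_const).mul
      (continuous_heatDeriv hf.integrable hs0 2)).div_const 2).aestronglyMeasurable
    (ae_of_all _ fun x r hr => ?_)
    (((hint.abs.add hPint).const_mul C₁).add (hPint.const_mul C₂))
    (ae_of_all _ fun x r hr => ?_)).2
  · refine h.congr_deriv ?_
    rw [integral_div, integral_log_mul_heatDeriv_two hf hint hs]; ring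
  · have h1 := H₁ r hr x
    have h2 := H₂ r hr x
    have hp := heatDeriv_zero_pos hf (ha.trans_le hr.1) x
    rw [Real.rpow_one, div_mul_cancel₀ _ hp.ne'] at h2
    have h3 : (-Real.log (heatDeriv f 0 r x) - 1) * heatDeriv f 2 r x =
        -(heatDeriv f 2 r x * Real.log (heatDeriv f 0 r x) + heatDeriv f 2 r x) := by ring
    rw [norm_div, Real.norm_eq_abs, Real.norm_two, h3, abs_neg]
    have h4 := abs_add_le (heatDeriv f 2 r x * Real.log (heatDeriv f 0 r x)) (heatDeriv f 2 r x)
    have h5 := abs_nonneg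
      (heatDeriv f 2 r x * Real.log (heatDeriv f 0 r x) + heatDeriv f 2 r x)
    linarith
  · have hr0 : 0 < r := ha.trans_le hr.1
    refine ((Real.hasDerivAt_negMulLog (heatDeriv_zero_pos hf hr0 x).ne').comp r
      (hasDerivAt_heatDeriv_time hf.integrable hr0 0 x)).congr_deriv ?_
    simp only [zero_add]; ring

/-- The time derivative of `∫ p ^ α`. The factor `1 - α`, which cancels the one in the definition of
the Tsallis entropy, comes from integrating `p ^ α v₂` by parts. -/
theorem hasDerivAt_ratioIntegral_one (hf : IsProbDensity f) (hα : 1 / 2 ≤ α)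
    (hint : Integrable fun x => heatDeriv f 0 T x ^ α) (hs : s ∈ Set.Ioo 0 T) :
    HasDerivAt (ratioIntegral f α 1)
      ((1 - α) * (α / 2 * ratioIntegral f α (MvPolynomial.X 1 ^ 2) s)) s := by
  refine (hasDerivAt_ratioIntegral hf hα hint hs 1).congr_deriv ?_
  have e : timeOp α 1 = MvPolynomial.C (α * (1 - α)) * MvPolynomial.X 1 ^ 2 +
      spaceOp α (MvPolynomial.C α * MvPolynomial.X 1) := by
    refine MvPolynomial.funext fun v => ?_
    simp [timeOp, spaceOp, timeDerivation, spaceDerivation, Derivation.leibniz,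
      MvPolynomial.mkDerivation_X]
    ring
  rw [e, ratioIntegral_add hf hα hint hs, ratioIntegral_C_mul,
    ratioIntegral_spaceOp hf hα hint hs]
  ring

/-- In `EReal` the difference `⊤ - ⊤` is `⊥`, so a finite Shannon entropy forces both the positive
and the negative part to have finite integral. -/
theorem integrable_negMulLog_of_renyiEntropy {g : ℝ → ℝ} (hg : Continuous g)
    (h₁ : renyiEntropy 1 g ≠ ⊥) (h₂ : renyiEntropy 1 g ≠ ⊤) :
    Integrable fun x => Real.negMulLog (g x) := by
  rw [renyiEntropy, if_pos rfl] at h₁ h₂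
  set A := ∫⁻ x, ENNReal.ofReal (Real.negMulLog (g x))
  set B := ∫⁻ x, ENNReal.ofReal (-Real.negMulLog (g x))
  have hB : B ≠ ⊤ := by
    intro h
    rw [h] at h₁
    simp at h₁
  have hA : A ≠ ⊤ := by
    intro h
    rw [h] at h₂
    rw [← ENNReal.coe_toNNReal hB] at h₂
    exact h₂ (EReal.top_sub_coe _)
  have hm : Continuous fun x => Real.negMulLog (g x) := Real.continuous_negMulLog.comp hg
  refine ⟨hm.aestronglyMeasurable, ?_⟩
  rw [HasFiniteIntegral]
  have : ∀ x, ‖Real.negMulLog (g x)‖ₑ = ENNReal.ofReal (Real.negMulLog (g x)) +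
      ENNReal.ofReal (-Real.negMulLog (g x)) := by
    intro x
    rw [Real.enorm_eq_ofReal_abs]
    rcases le_total 0 (Real.negMulLog (g x)) with h | h
    · rw [abs_of_nonneg h, ENNReal.ofReal_of_nonpos (neg_nonpos.2 h), add_zero]
    · rw [abs_of_nonpos h, ENNReal.ofReal_of_nonpos h, zero_add]
  simp only [this]
  rw [lintegral_add_left hm.measurable.ennreal_ofReal]
  exact ENNReal.add_lt_top.2 ⟨hA.lt_top, hB.lt_top⟩

theorem integrable_rpow_of_renyiEntropy {g : ℝ → ℝ} (hg : Continuous g) (hpos : ∀ x, 0 < g x)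
    (hα : α ≠ 1) (h₁ : renyiEntropy α g ≠ ⊥) (h₂ : renyiEntropy α g ≠ ⊤) :
    Integrable fun x => g x ^ α := by
  rw [renyiEntropy, if_neg hα] at h₁ h₂
  have hm : Continuous fun x => g x ^ α := hg.rpow_const fun x => Or.inl (hpos x).ne'
  refine ⟨hm.aestronglyMeasurable, ?_⟩
  rw [HasFiniteIntegral]
  have : ∀ x, ‖g x ^ α‖ₑ = ENNReal.ofReal (g x ^ α) := fun x =>
    Real.enorm_of_nonneg (Real.rpow_nonneg (hpos x).le _)
  simp only [this]
  refine lt_top_iff_ne_top.2 fun h => ?_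
  rw [h, ENNReal.log_top] at h₁ h₂
  rcases lt_or_gt_of_ne hα with h | h
  · exact h₂ (EReal.coe_mul_top_of_pos (by have := sub_pos.2 h; positivity))
  · exact h₁ (EReal.coe_mul_top_of_neg (one_div_neg.2 (sub_neg.2 h)))

/-- At every time before a time `T` of finite Rényi entropy, the Tsallis entropy is finite (for
`α ≠ 1` by domination by `P ^ α`), and its derivative is a multiple of the generalized Fisher
information `∫ p ^ α (∂ₓ p / p) ^ 2`. -/
theorem hasDerivAt_tsallisEntropy (hf : IsProbDensity f) (hα : 1 / 2 ≤ α)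
    (hT0 : 0 < T) (h₁ : renyiEntropy α (heatDensity f T) ≠ ⊥)
    (h₂ : renyiEntropy α (heatDensity f T) ≠ ⊤) :
    (Integrable fun x => heatDeriv f 0 T x ^ α) ∧ ∀ s ∈ Set.Ioo 0 T,
      (α = 1 → Integrable fun x => Real.negMulLog (heatDensity f s x)) ∧
      HasDerivAt (fun s => tsallisEntropy α (heatDensity f s))
        (α / 2 * ratioIntegral f α (MvPolynomial.X 1 ^ 2) s) s := by
  have e : ∀ s, heatDensity f s = heatDeriv f 0 s := fun s =>
    funext fun x => (heatDeriv_zero f s x).symm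
  simp only [e] at h₁ h₂ ⊢
  have hcont := continuous_heatDeriv hf.integrable hT0 0
  rcases eq_or_ne α 1 with rfl | hα1
  · have hint := integrable_negMulLog_of_renyiEntropy hcont h₁ h₂
    refine ⟨by simpa using integrable_heatDeriv_zero hf.integrable hT0, fun s hs => ⟨fun _ => ?_,
      ?_⟩⟩
    · exact (integrable_heatDeriv_mul_log hf hint hs 0).neg.congr (ae_of_all _ fun x => by
        simp only [Pi.neg_apply, Real.negMulLog]; ring)
    · simpa only [tsallisEntropy, if_true] using hasDerivAt_shannonEntropy hf hint hs
  · have hint := integrable_rpow_of_renyiEntropy hcont (heatDeriv_zero_pos hf hT0) hα1 h₁ h₂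
    refine ⟨hint, fun s hs => ⟨fun h => absurd h hα1, ?_⟩⟩
    refine (((hasDerivAt_ratioIntegral_one hf hα hint hs).sub_const 1).const_mul
      (1 / (1 - α))).congr_fun_deriv (fun r => ?_) ?_
    · simp [tsallisEntropy, hα1, ratioIntegral]
    · have : 1 - α ≠ 0 := sub_ne_zero.2 hα1.symm
      field_simp

end Entropy

/-! ### The sign of the fourth derivative -/

theorem iteratedDeriv_eq_of_hasDerivAt {U : Set ℝ} (hU : IsOpen U) {n : ℕ} {G : ℕ → ℝ → ℝ}
    (h : ∀ k < n, ∀ s ∈ U, HasDerivAt (G k) (G (k + 1) s) s) :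
    ∀ k ≤ n, ∀ s ∈ U, iteratedDeriv k (G 0) s = G k s := by
  intro k
  induction k with
  | zero => intro _ s _; rw [iteratedDeriv_zero]
  | succ k ih =>
    intro hk s hs
    have he : iteratedDeriv k (G 0) =ᶠ[𝓝 s] G k :=
      Filter.eventuallyEq_of_mem (hU.mem_nhds hs) (ih (by omega))
    rw [iteratedDeriv_succ, he.deriv_eq, (h k (by omega) s hs).deriv]

theorem mainTheorem2 (f : ℝ → ℝ) (hf : IsProbDensity f) (α : ℝ) (hα : α ∈ Set.Icc (0.93 : ℝ) 2)
    (t : ℝ) (ht : 0 < t) (htα : (t : EReal) < entropyTime α f) :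
    -- the Tsallis entropy of `p(·,t)` is finite
    ((α = 1 → MeasureTheory.Integrable (fun x => Real.negMulLog (heatDensity f t x))) ∧
      (α ≠ 1 → MeasureTheory.Integrable (fun x => heatDensity f t x ^ α))) ∧
    -- it is four times differentiable in the time variable
    (∀ k < 4, DifferentiableAt ℝ
      (iteratedDeriv k (fun s : ℝ => tsallisEntropy α (heatDensity f s))) t) ∧
    -- and its fourth derivative is nonpositive
    iteratedDeriv 4 (fun s : ℝ => tsallisEntropy α (heatDensity f s)) t ≤ 0 := by
  obtain ⟨_, ⟨T, ⟨hT0, h₁, h₂⟩, rfl⟩, htT⟩ := lt_sSup_iff.1 htα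
  have htT : t < T := EReal.coe_lt_coe_iff.1 htT
  have hα0 : 1 / 2 ≤ α := by have := hα.1; norm_num at this ⊢; linarith
  obtain ⟨hint, H⟩ := hasDerivAt_tsallisEntropy hf hα0 hT0 h₁ h₂
  have htm : t ∈ Set.Ioo 0 T := ⟨ht, htT⟩
  obtain ⟨β, rfl⟩ : ∃ β, α = 2 - β := ⟨2 - α, by ring⟩
  -- the successive time derivatives: each application of `timeOp` contributes a factor `1 / 2`
  let G : ℕ → ℝ → ℝ := fun k s => match k with
    | 0 => tsallisEntropy (2 - β) (heatDensity f s)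
    | 1 => (2 - β) / 2 * ratioIntegral f (2 - β) (MvPolynomial.X 1 ^ 2) s
    | 2 => (2 - β) / 4 * ratioIntegral f (2 - β) (secondPoly β) s
    | 3 => (2 - β) / 8 * ratioIntegral f (2 - β) (thirdPoly β) s
    | _ => (2 - β) / 16 * ratioIntegral f (2 - β) (timeOp (2 - β) (thirdPoly β)) s
  have hsum : ∀ {s}, s ∈ Set.Ioo 0 T → ∀ Q W,
      ratioIntegral f (2 - β) (Q + spaceOp (2 - β) W) s = ratioIntegral f (2 - β) Q s := by
    intro s hs Q W
    rw [ratioIntegral_add hf hα0 hint hs, ratioIntegral_spaceOp hf hα0 hint hs, add_zero]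
  have hG : ∀ k < 4, ∀ s ∈ Set.Ioo 0 T, HasDerivAt (G k) (G (k + 1) s) s := by
    intro k hk s hs
    interval_cases k
    · exact (H s hs).2
    · refine ((hasDerivAt_ratioIntegral hf hα0 hint hs _).const_mul _).congr_deriv ?_
      rw [timeOp_firstPoly, hsum hs]
      simp only [G]; ring
    · refine ((hasDerivAt_ratioIntegral hf hα0 hint hs _).const_mul _).congr_deriv ?_
      rw [timeOp_secondPoly, hsum hs]
      simp only [G]; ring
    · refine ((hasDerivAt_ratioIntegral hf hα0 hint hs _).const_mul _).congr_deriv ?_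
      simp only [G]; ring
  have hI := iteratedDeriv_eq_of_hasDerivAt isOpen_Ioo hG
  refine ⟨⟨(H t htm).1, fun _ => ?_⟩, fun k hk => ?_, ?_⟩
  · have h := integrable_rpow_mul_eval hf hα0 hint htm 1
    simpa [heatDeriv_zero] using h
  · exact (hG k hk t htm).differentiableAt.congr_of_eventuallyEq
      (Filter.eventuallyEq_of_mem (isOpen_Ioo.mem_nhds htm) (hI k hk.le))
  · refine (hI 4 le_rfl t htm).trans_le ?_
    obtain ⟨W, hW⟩ := exists_eval_timeOp_thirdPoly_nonpos (β := β) (by linarith [hα.2])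
      (by have := hα.1; norm_num at this ⊢; linarith)
    have hnonpos : ratioIntegral f (2 - β) (timeOp (2 - β) (thirdPoly β)) t ≤ 0 := by
      rw [← hsum htm _ W]
      exact integral_nonpos fun x => mul_nonpos_of_nonneg_of_nonpos
        (Real.rpow_nonneg (heatDeriv_zero_pos hf ht x).le _) (hW _)
    exact mul_nonpos_of_nonneg_of_nonpos (by linarith) hnonpos
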